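/- For a matroid $M$ on a finite ground set, let $L(M)$ be its lattice of flats, and for a flat $F$ let $M_F$ be the contraction of $M$ by $F$. The Kazhdan--Lusztig polynomials $P_M(t)\in\mathbb{Z}[t]$ are the unique family of polynomials, indexed by the loopless matroids on finite ground sets, such that (a) $P_M(t)=1$ if $\operatorname{rk} M=0$; (b) $\deg P_M(t)<(\operatorname{rk} M)/2$ if $\operatorname{rk} M>0$; (c) the polynomial $Z_M(t)=\sum_{F\in L(M)}t^{\operatorname{rk}F}P_{M_F}(t)$ satisfies $Z_M(t)=t^{\operatorname{rk}M}Z_M(t^{-1})$ for every $M$. For a finite simple graph $G$, let $P_G(t)=P_{M_G}(t)$, where $M_G$ is the graphic matroid of $G$: its ground set is the edge set of $G$, and its independent sets are the sets of edges that contain no cycle. Let $G$ be a finite simple graph that is the parallel connection of subgraphs $H_1$ and $H_2$ with connection edge $e$; that is, $H_1\cup H_2=G$, and $H_1\cap H_2$ consists of the single edge $e$ together with its two end vertices. Suppose that the graphs $H_1\smallsetminus e$ and $H_2\smallsetminus e$, obtained by deleting the edge $e$ and keeping all vertices, are both connected. Then \[P_G(t)=P_{G\smallsetminus e}(t)-t\,P_{H_1/e}(t)\,P_{H_2/e}(t),\]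 where $H_i/e$ is the simple graph obtained from $H_i$ by contracting $e$ and identifying any multiple edges that result. -/

import Mathlib

open Polynomial

/-! ### Kazhdan--Lusztig polynomials of matroids -/

namespace Matroid

variable {α : Type*}

/-- The rank of a set in a matroid of finite rank, as a natural number. -/
noncomputable def natRk (M : Matroid α) (X : Set α) : ℕ := (M.eRk X).toNat

/-- The rank of a matroid of finite rank, as a natural number. -/
noncomputable def natRank (M : Matroid α) : ℕ := M.eRank.toNat

/-- The set of flats of a matroid on a finite type. -/
noncomputable def flats [Finite α] (M : Matroid α) : Finset (Set α) :=
  (Set.toFinite {F | M.IsFlat F}).toFinset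

/-- `f` is palindromic of degree `n`: `f(t) = t ^ n * f(t⁻¹)` in `ℤ[t, t⁻¹]`. -/
def IsPal (n : ℕ) (f : ℤ[X]) : Prop :=
  toLaurent f = LaurentPolynomial.T (n : ℤ) * LaurentPolynomial.invert (toLaurent f)

/-- The `Z`-polynomial attached to a family `P` of polynomials:
the sum over all flats `F` of `t ^ (rk F) * P (M ／ F)`. -/
noncomputable def zPoly [Finite α] (P : Matroid α → ℤ[X]) (M : Matroid α) : ℤ[X] :=
  ∑ F ∈ M.flats, X ^ M.natRk F * P (M ／ F)

/-- The defining properties of the family of Kazhdan--Lusztig polynomials. They are imposed on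
loopless matroids (where `∅` is the least flat, and `M ／ ∅ = M`); every contraction by a
flat is loopless. As the lattice of flats does not see loops, a matroid with loops is given the
polynomial of the matroid without them. -/
structure IsKLFamily [Finite α] (P : Matroid α → ℤ[X]) : Prop where
  removeLoops : ∀ M, P M.removeLoops = P M
  rank_zero : ∀ M : Matroid α, M.Loopless → M.natRank = 0 → P M = 1
  degree_lt : ∀ M : Matroid α, M.Loopless → 0 < M.natRank → 2 * (P M).natDegree < M.natRank
  palindromic : ∀ M : Matroid α, M.Loopless → IsPal M.natRank (zPoly P M)

theorem mem_flats [Finite α] {M : Matroid α} {F : Set α} : F ∈ M.flats ↔ M.IsFlat F := by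
  simp [flats]

theorem isPal_iff {n : ℕ} {f : ℤ[X]} :
    IsPal n f ↔ (∀ i j, i + j = n → f.coeff i = f.coeff j) ∧ ∀ i, n < i → f.coeff i = 0 := by
  have hnat (g : ℤ[X]) (k : ℕ) : (toLaurent g).coeff (k : ℤ) = g.coeff k := by
    rw [LaurentPolynomial.coeff_toLaurent]
    exact Finsupp.mapDomain_apply Nat.castEmbedding.injective _ k
  have hneg (g : ℤ[X]) (k : ℤ) (hk : k < 0) : (toLaurent g).coeff k = 0 := by
    rw [LaurentPolynomial.coeff_toLaurent]
    refine Finsupp.mapDomain_of_notMem_range _ _ ?_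
    rintro ⟨m, rfl⟩
    simp at hk
    omega
  have hT (g : LaurentPolynomial ℤ) (k : ℤ) :
      (LaurentPolynomial.T (n : ℤ) * LaurentPolynomial.invert g).coeff k = g.coeff (n - k) := by
    rw [LaurentPolynomial.T]
    have := AddMonoidAlgebra.coeff_single_mul_apply (LaurentPolynomial.invert g) (1 : ℤ) (n : ℤ) k
    rw [this, LaurentPolynomial.invert_apply, one_mul]
    congr 1
    ring
  constructor
  · intro h
    have h' (k : ℤ) : (toLaurent f).coeff k = (toLaurent f).coeff (n - k) := by
      conv_lhs => rw [h]
      exact hT _ k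
    refine ⟨fun i j hij => ?_, fun i hi => ?_⟩
    · rw [← hnat, ← hnat, h']
      congr 1
      omega
    · rw [← hnat, h', hneg _ _ (by omega)]
  · rintro ⟨h1, h2⟩
    refine LaurentPolynomial.ext fun k => ?_
    rw [hT]
    rcases lt_or_ge k 0 with hk | hk
    · obtain ⟨m, hm⟩ := Int.eq_ofNat_of_zero_le (show 0 ≤ (n : ℤ) - k by omega)
      rw [hneg _ _ hk, hm, hnat, h2 _ (by omega)]
    · obtain ⟨m, rfl⟩ := Int.eq_ofNat_of_zero_le hk
      rw [hnat]
      rcases lt_or_ge n m with hm | hm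
      · rw [hneg _ _ (by omega), h2 _ hm]
      · rw [h1 m (n - m) (by omega), ← hnat]
        congr 1
        omega

theorem natRank_contract_add [Finite α] (M : Matroid α) {F : Set α} (hF : M.IsFlat F) :
    (M ／ F).natRank + M.natRk F = M.natRank := by
  obtain ⟨I, hI⟩ := M.exists_isBasis F hF.subset_ground
  obtain ⟨J, hJ⟩ := (M ／ F).exists_isBase
  have hJi := hI.contract_indep_iff.1 hJ.indep
  have hdisj : Disjoint J I := hJi.2.symm.mono_right hI.subset
  have hB : M.IsBase (J ∪ I) := by
    refine hJi.1.isBase_of_maximal fun K hK hJK => ?_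
    refine hJK.antisymm fun a ha => ?_
    by_contra hna
    have haF : a ∉ F := fun haF => hna (Or.inr ((hI.eq_of_subset_indep
      (hK.subset (Set.insert_subset ha (Set.subset_union_right.trans hJK)))
      (Set.subset_insert a I) (Set.insert_subset haF hI.subset)) ▸ Set.mem_insert a I))
    have : (M ／ F).Indep (insert a J) := by
      rw [hI.contract_indep_iff]
      refine ⟨hK.subset ?_, ?_⟩
      · rw [Set.insert_union]
        exact Set.insert_subset ha hJK
      · rw [Set.disjoint_insert_right]
        exact ⟨haF, hJi.2⟩
    exact hna (Or.inl (hJ.eq_of_subset_indep this (Set.subset_insert a J) ▸ Set.mem_insert a J))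
  rw [natRank, natRank, natRk, ← hJ.encard_eq_eRank, ← hB.encard_eq_eRank, ← hI.encard_eq_eRk,
    Set.encard_union_eq hdisj, ENat.toNat_add]
  · exact (Set.toFinite J).encard_lt_top.ne
  · exact (Set.toFinite I).encard_lt_top.ne

theorem natRk_pos [Finite α] {M : Matroid α} [M.Loopless] {F : Set α} (hF : M.IsFlat F)
    (hne : F ≠ ∅) : 0 < M.natRk F := by
  rw [natRk, Nat.pos_iff_ne_zero, Ne, ENat.toNat_eq_zero, not_or]
  constructor
  · rw [eRk_eq_zero_iff hF.subset_ground, loops_eq_empty]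
    exact fun h => hne (Set.subset_empty_iff.1 h)
  · exact ((M.eRk_le_encard F).trans_lt (Set.toFinite F).encard_lt_top).ne

theorem loopless_contract {M : Matroid α} {F : Set α} (hF : M.IsFlat F) : (M ／ F).Loopless :=
  ⟨by rw [contract_loops_eq, hF.closure, Set.sdiff_self]⟩

/-- The explicit recursion that solves the defining properties. -/
noncomputable def klRec [Finite α] (M : Matroid α) : ℤ[X] :=
  open Classical in
  letI := Fintype.ofFinite {F : Set α // M.IsFlat F ∧ (M ／ F).natRank < M.natRank}
  if M.natRank = 0 then 1 else
  let f : ℤ[X] := ∑ F : {F : Set α // M.IsFlat F ∧ (M ／ F).natRank < M.natRank},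
    X ^ M.natRk F.1 * klRec (M ／ F.1)
  ∑ k ∈ (Finset.range M.natRank).filter (fun k => 2 * k < M.natRank),
    C (f.coeff (M.natRank - k) - f.coeff k) * X ^ k
termination_by M.natRank
decreasing_by exact F.2.2

theorem empty_mem_flats [Finite α] (M : Matroid α) [M.Loopless] : ∅ ∈ M.flats := by
  rw [mem_flats, ← M.loops_eq_empty]
  exact isFlat_closure ∅

open Classical in
theorem zPoly_eq [Finite α] (P : Matroid α → ℤ[X]) (M : Matroid α) [M.Loopless] :
    zPoly P M = P M + ∑ F ∈ M.flats.erase ∅, X ^ M.natRk F * P (M ／ F) := by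
  rw [zPoly, ← Finset.add_sum_erase _ _ M.empty_mem_flats]
  simp [natRk]

theorem natRank_contract_lt [Finite α] {M : Matroid α} [M.Loopless] {F : Set α}
    (hF : M.IsFlat F) (hne : F ≠ ∅) : (M ／ F).natRank < M.natRank := by
  have := M.natRank_contract_add hF
  have := natRk_pos hF hne
  omega

open Classical in
theorem klRec_eq [Finite α] (M : Matroid α) [M.Loopless] (h : M.natRank ≠ 0) :
    klRec M = ∑ k ∈ (Finset.range M.natRank).filter (fun k => 2 * k < M.natRank),
      C ((∑ F ∈ M.flats.erase ∅, X ^ M.natRk F * klRec (M ／ F)).coeff (M.natRank - k) -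
        (∑ F ∈ M.flats.erase ∅, X ^ M.natRk F * klRec (M ／ F)).coeff k) * X ^ k := by
  let _ := Fintype.ofFinite {F : Set α // M.IsFlat F ∧ (M ／ F).natRank < M.natRank}
  have hsum : ∑ F ∈ M.flats.erase ∅, X ^ M.natRk F * klRec (M ／ F) =
      ∑ F : {F : Set α // M.IsFlat F ∧ (M ／ F).natRank < M.natRank},
        X ^ M.natRk F.1 * klRec (M ／ F.1) := by
    refine Finset.sum_subtype (M.flats.erase ∅) (fun F => ?_)
      (fun F => X ^ M.natRk F * klRec (M ／ F))
    rw [Finset.mem_erase, mem_flats]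
    refine ⟨fun h => ⟨h.2, natRank_contract_lt h.2 h.1⟩, fun h => ⟨?_, h.1⟩⟩
    rintro rfl
    simpa using h.2
  rw [hsum]
  conv_lhs => rw [klRec]
  rw [if_neg h]

open Classical in
theorem klRec_coeff [Finite α] (M : Matroid α) [M.Loopless] (h : M.natRank ≠ 0) (i : ℕ) :
    (klRec M).coeff i = if 2 * i < M.natRank then
      (∑ F ∈ M.flats.erase ∅, X ^ M.natRk F * klRec (M ／ F)).coeff (M.natRank - i) -
        (∑ F ∈ M.flats.erase ∅, X ^ M.natRk F * klRec (M ／ F)).coeff i else 0 := by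
  rw [klRec_eq M h, finsetSum_coeff]
  simp only [coeff_C_mul_X_pow]
  rw [Finset.sum_ite_eq]
  simp only [Finset.mem_filter, Finset.mem_range]
  congr 1
  exact propext ⟨fun h => h.2, fun h => ⟨by omega, h⟩⟩

theorem klRec_rank_zero [Finite α] (M : Matroid α) (h : M.natRank = 0) : klRec M = 1 := by
  rw [klRec, if_pos h]

theorem klRec_degree [Finite α] (M : Matroid α) [M.Loopless] (h : M.natRank ≠ 0) :
    2 * (klRec M).natDegree < M.natRank := by
  by_contra hcon
  have h0 : (klRec M).coeff (klRec M).natDegree = 0 := by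
    rw [klRec_coeff M h, if_neg hcon]
  rw [coeff_natDegree, leadingCoeff_eq_zero] at h0
  rw [h0] at hcon
  simp at hcon
  omega

open Classical in
theorem klRec_palindromic [Finite α] (M : Matroid α) [M.Loopless] :
    IsPal M.natRank (zPoly klRec M) := by
  have hdeg (N : Matroid α) (hN : N.Loopless) : (klRec N).natDegree ≤ N.natRank := by
    by_cases h : N.natRank = 0
    · simp [klRec_rank_zero N h]
    · have := klRec_degree N h
      omega
  rw [isPal_iff]
  constructor
  · have key : ∀ i j, i + j = M.natRank → i < j →
        (zPoly klRec M).coeff i = (zPoly klRec M).coeff j := by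
      intro i j hij hlt
      have h : M.natRank ≠ 0 := by omega
      rw [zPoly_eq, coeff_add, coeff_add, klRec_coeff M h, klRec_coeff M h, if_pos (by omega),
        if_neg (by omega), show M.natRank - i = j by omega]
      ring
    intro i j hij
    rcases lt_trichotomy i j with h | h | h
    · exact key i j hij h
    · rw [h]
    · exact (key j i (by omega) h).symm
  · intro i hi
    rw [zPoly, finsetSum_coeff]
    refine Finset.sum_eq_zero fun F hF => ?_
    rw [mem_flats] at hF
    have h1 := M.natRank_contract_add hF
    have h2 := hdeg _ (loopless_contract hF)
    rw [coeff_X_pow_mul', if_pos (by omega)]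
    exact coeff_eq_zero_of_natDegree_lt (by omega)

/-- There is exactly one family of polynomials with the defining properties. -/
theorem existsUnique_isKLFamily (α : Type*) [Finite α] :
    ∃! P : Matroid α → ℤ[X], IsKLFamily P := by
  classical
  refine ⟨fun M => klRec M.removeLoops, ⟨fun M => ?_, fun M hM h => ?_, fun M hM h => ?_,
    fun M hM => ?_⟩, fun P hP => ?_⟩
  · simp
  · simpa using klRec_rank_zero M h
  · simpa using klRec_degree M h.ne'
  · convert klRec_palindromic M using 1
    refine Finset.sum_congr rfl fun F hF => ?_
    have := loopless_contract (mem_flats.1 hF)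
    simp only [removeLoops_eq_self]
  · suffices H : ∀ n : ℕ, ∀ M : Matroid α, M.Loopless → M.natRank = n → P M = klRec M by
      funext M
      rw [← hP.removeLoops, H _ _ inferInstance rfl]
    intro n
    induction n using Nat.strong_induction_on with
    | _ n ih =>
      intro M hM hn
      by_cases h0 : M.natRank = 0
      · rw [hP.rank_zero M hM h0, klRec_rank_zero M h0]
      have h1 := (isPal_iff.1 (hP.palindromic M hM)).1
      have h2 := (isPal_iff.1 (klRec_palindromic M)).1
      have hs : ∑ F ∈ M.flats.erase ∅, X ^ M.natRk F * P (M ／ F) =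
          ∑ F ∈ M.flats.erase ∅, X ^ M.natRk F * klRec (M ／ F) := by
        refine Finset.sum_congr rfl fun F hF => ?_
        rw [Finset.mem_erase, mem_flats] at hF
        rw [ih _ (hn ▸ natRank_contract_lt hF.2 hF.1) _ (loopless_contract hF.2) rfl]
      have hd1 := hP.degree_lt M hM (Nat.pos_of_ne_zero h0)
      have hd2 := klRec_degree M h0
      rw [zPoly_eq, hs] at h1
      rw [zPoly_eq] at h2
      ext i
      by_cases hi : 2 * i < M.natRank
      · have e1 := h1 i (M.natRank - i) (by omega)
        have e2 := h2 i (M.natRank - i) (by omega)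
        rw [coeff_add, coeff_add] at e1 e2
        rw [coeff_eq_zero_of_natDegree_lt (show (P M).natDegree < M.natRank - i by omega)] at e1
        rw [coeff_eq_zero_of_natDegree_lt
          (show (klRec M).natDegree < M.natRank - i by omega)] at e2
        linarith
      · rw [coeff_eq_zero_of_natDegree_lt (by omega), coeff_eq_zero_of_natDegree_lt (by omega)]

/-- The Kazhdan--Lusztig polynomial of a matroid on a finite type. -/
noncomputable def klPoly [Finite α] (M : Matroid α) : ℤ[X] :=
  (existsUnique_isKLFamily α).choose M

end Matroid

/-! ### Graphs -/

namespace SimpleGraph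

variable {V : Type*}

/-- The independent sets of the graphic matroid are the edge sets of forests. -/
def graphicIndepMatroid [Finite V] (G : SimpleGraph V) : IndepMatroid (Sym2 V) :=
  IndepMatroid.ofBdd G.edgeSet (fun I => I ⊆ G.edgeSet ∧ (fromEdgeSet I).IsAcyclic)
    (by simp)
    (fun I J hJ hIJ => ⟨hIJ.trans hJ.1, hJ.2.anti (fromEdgeSet_mono hIJ)⟩)
    (by
      rintro I B hI hImax hB
      have hfrom {S : Set (Sym2 V)} (hS : S ⊆ G.edgeSet) : (fromEdgeSet S).edgeSet = S := by
        rw [edgeSet_fromEdgeSet, sdiff_eq_left]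
        exact Set.disjoint_left.2 fun e he => G.not_isDiag_of_mem_edgeSet (hS he)
      have hle {S : Set (Sym2 V)} (hS : S ⊆ G.edgeSet) : fromEdgeSet S ≤ G := by
        rw [← edgeSet_subset_edgeSet, hfrom hS]
        exact hS
      have hmax {S : Set (Sym2 V)} (hS : S ⊆ G.edgeSet ∧ (fromEdgeSet S).IsAcyclic) :
          Maximal (fun I => I ⊆ G.edgeSet ∧ (fromEdgeSet I).IsAcyclic) S ↔
            (fromEdgeSet S).Reachable = G.Reachable := by
        rw [← maximal_isAcyclic_iff_reachable_eq (hle hS.1) hS.2]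
        refine ⟨fun h => ⟨⟨hle hS.1, hS.2⟩, fun K hK hSK => ?_⟩,
          fun h => ⟨hS, fun K hK hSK => ?_⟩⟩
        · have := h.2 (y := K.edgeSet) ⟨edgeSet_mono hK.1, by simpa using hK.2⟩
            (by rw [← hfrom hS.1]; exact edgeSet_mono hSK)
          rw [← fromEdgeSet_edgeSet K]
          exact fromEdgeSet_mono this
        · have := h.2 ⟨hle hK.1, hK.2⟩ (fromEdgeSet_mono hSK)
          rw [← edgeSet_subset_edgeSet, hfrom hK.1, hfrom hS.1] at this
          exact this
      rw [hmax hI] at hImax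
      have hBr := (hmax hB.prop).1 hB
      by_contra hcon
      refine hImax ?_
      have hadj : ∀ u v, (fromEdgeSet B).Adj u v → (fromEdgeSet I).Reachable u v := by
        intro u v huv
        by_contra hr
        have huvB : s(u, v) ∈ B := ((fromEdgeSet_adj B).1 huv).1
        have huvI : s(u, v) ∉ I := fun h =>
          hr (Adj.reachable ((fromEdgeSet_adj I).2 ⟨h, huv.ne⟩))
        refine hcon ⟨_, ⟨huvB, huvI⟩, Set.insert_subset (hB.prop.1 huvB) hI.1, ?_⟩
        have := hI.2.sup_edge_of_not_reachable hr
        rwa [edge, ← fromEdgeSet_union, Set.union_singleton] at this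
      ext u v
      refine ⟨fun h => h.mono (hle hI.1), fun h => ?_⟩
      rw [← hBr] at h
      obtain ⟨p⟩ := h
      induction p with
      | nil => exact Reachable.refl _
      | cons h _ ih => exact (hadj _ _ h).trans ih)
    (fun I hI => hI.1)
    ⟨(Set.univ : Set (Sym2 V)).ncard, fun I _ => by
      rw [(Set.toFinite _).cast_ncard_eq]
      exact Set.encard_le_encard (Set.subset_univ I)⟩

/-- The graphic matroid of a finite graph: the ground set is the set of edges, and a set of edges
is independent if it contains no cycle. -/
def graphicMatroid [Finite V] (G : SimpleGraph V) : Matroid (Sym2 V) :=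
  G.graphicIndepMatroid.matroid

/-- The Kazhdan--Lusztig polynomial of a finite graph. -/
noncomputable def klPoly [Finite V] (G : SimpleGraph V) : ℤ[X] :=
  G.graphicMatroid.klPoly

/-- The contraction `G / e` of the edge `e = xy`: the vertices `x` and `y` are identified, and
loops and multiple edges that arise are removed and identified, respectively. -/
def contractEdge (G : SimpleGraph V) (x y : V) :
    SimpleGraph (Quot fun a b : V => a = x ∧ b = y) :=
  G.map (Quot.mk _)

/-- `G` is the parallel connection of its subgraphs `H₁` and `H₂` with connection edge `xy`:
their union is `G`, and their intersection is the edge `xy` together with its end vertices. -/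
structure IsParallelConnection {G : SimpleGraph V} (H₁ H₂ : G.Subgraph) {x y : V}
    (e : G.Adj x y) : Prop where
  sup_eq : H₁ ⊔ H₂ = ⊤
  inf_eq : H₁ ⊓ H₂ = G.subgraphOfAdj e

theorem IsParallelConnection.adj_left {G : SimpleGraph V} {H₁ H₂ : G.Subgraph} {x y : V}
    {e : G.Adj x y} (h : IsParallelConnection H₁ H₂ e) : H₁.Adj x y := by
  have : (H₁ ⊓ H₂).Adj x y := by simp [h.inf_eq]
  exact this.1

theorem IsParallelConnection.adj_right {G : SimpleGraph V} {H₁ H₂ : G.Subgraph} {x y : V}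
    {e : G.Adj x y} (h : IsParallelConnection H₁ H₂ e) : H₂.Adj x y := by
  have : (H₁ ⊓ H₂).Adj x y := by simp [h.inf_eq]
  exact this.2

/-- The contraction `H / e` of a subgraph `H` along its edge `e = xy`, as a graph. -/
def Subgraph.contractEdge {G : SimpleGraph V} (H : G.Subgraph) {x y : V} (e : H.Adj x y) :
    SimpleGraph (Quot fun a b : H.verts => a = ⟨x, e.fst_mem⟩ ∧ b = ⟨y, e.snd_mem⟩) :=
  H.coe.contractEdge ⟨x, e.fst_mem⟩ ⟨y, e.snd_mem⟩

end SimpleGraph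

/-! Write M for the graphic matroid of G. The formula is the deletion formula for Kazhdan--Lusztig
polynomials in a case where its correction terms vanish. Let e be an element that is neither a
coloop nor parallel to another element, and put Q = P_{M∖e} - t P_{M/e}. Arguing by induction on the
rank, substitute the formula for P_{M/F} at each nonempty flat F avoiding e. The sum of Q and the
terms t^{rk F} P_{M/F} over nonempty F then collapses to Z_{M∖e}, which is palindromic of degree rk
M because e is not a coloop. If Q also satisfies the degree bound, uniqueness (`klPoly_eq_of_isPal`)
forces Q = P_M. This is `klPoly_eq_deleteElem_sub`; its only delicate hypothesis is that P_{M/(F ∪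
e)} never reaches degree (rk - 1)/2, where rk is the rank of M/(F ∪ e), when F and F ∪ e are flats
and e ∉ F.

For a parallel connection, M/e is the direct sum of the contractions coming from H₁ and H₂
(`isDirectSum_contract`), and polynomials multiply over direct sums (`IsDirectSum.klPoly_eq`). After
further contraction by F, both summands still have positive rank, by the connectedness of each Hᵢ∖e
(`natRank_contract_pos`). The strict degree bounds of the two factors therefore add up to one unit
more than the usual bound, which is exactly the delicate hypothesis.

Each summand is compared with the simple graph Hᵢ/e by a map that may identify parallel elements but
preserves the lattice of flats (`IsClosureMap.klPoly_eq`). -/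

namespace Matroid

variable {α β : Type*}

/-! ### Generalities on Kazhdan--Lusztig polynomials -/

theorem isKLFamily_klPoly [Finite α] : IsKLFamily (klPoly : Matroid α → ℤ[X]) :=
  (existsUnique_isKLFamily α).choose_spec.1

theorem IsPal.mul {m n : ℕ} {f g : ℤ[X]} (hf : IsPal m f) (hg : IsPal n g) :
    IsPal (m + n) (f * g) := by
  unfold IsPal at *
  rw [map_mul, map_mul, Nat.cast_add, LaurentPolynomial.T_add]
  conv_lhs => rw [hf, hg]
  ring

/-- The weak inequality also covers rank zero, as needed when one summand of a direct sum has rank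
zero. -/
theorem two_mul_natDegree_klPoly_le [Finite α] (M : Matroid α) [M.Loopless] :
    2 * (klPoly M).natDegree ≤ M.natRank := by
  rcases Nat.eq_zero_or_pos M.natRank with h | h
  · simp [isKLFamily_klPoly.rank_zero M inferInstance h]
  · exact (isKLFamily_klPoly.degree_lt M inferInstance h).le

open Classical in
/-- The Kazhdan--Lusztig polynomial is determined by those of the proper contractions, the degree
bound and the palindromicity of the `Z`-polynomial. -/
theorem klPoly_eq_of_isPal [Finite α] {M : Matroid α} [M.Loopless] {Q : ℤ[X]}
    (h0 : M.natRank = 0 → Q = 1) (hd : 0 < M.natRank → 2 * Q.natDegree < M.natRank)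
    (hp : IsPal M.natRank (Q + ∑ F ∈ M.flats.erase ∅, X ^ M.natRk F * klPoly (M ／ F))) :
    klPoly M = Q := by
  have hK := isKLFamily_klPoly (α := α)
  rcases Nat.eq_zero_or_pos M.natRank with h | h
  · rw [hK.rank_zero M inferInstance h, h0 h]
  have h1 := (isPal_iff.1 (hK.palindromic M inferInstance)).1
  have h2 := (isPal_iff.1 hp).1
  have hd1 := hK.degree_lt M inferInstance h
  have hd2 := hd h
  rw [zPoly_eq] at h1
  ext i
  by_cases hi : 2 * i < M.natRank
  -- Below the middle degree, neither candidate has a coefficient at the mirror index, so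
  -- palindromicity expresses coefficient `i` through the common sum over nonempty flats.
  · have e1 := h1 i (M.natRank - i) (by omega)
    have e2 := h2 i (M.natRank - i) (by omega)
    rw [coeff_add, coeff_add] at e1 e2
    rw [coeff_eq_zero_of_natDegree_lt
      (show (klPoly M).natDegree < M.natRank - i by omega)] at e1
    rw [coeff_eq_zero_of_natDegree_lt (show Q.natDegree < M.natRank - i by omega)] at e2
    linarith
  · rw [coeff_eq_zero_of_natDegree_lt (by omega), coeff_eq_zero_of_natDegree_lt (by omega)]

theorem contract_isFlat_iff {M : Matroid α} {C F : Set α} (hC : C ⊆ M.E) :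
    (M ／ C).IsFlat F ↔ M.IsFlat (F ∪ C) ∧ Disjoint F C := by
  rw [isFlat_iff_closure_eq, isFlat_iff_closure_eq, contract_closure_eq]
  have hsub : C ⊆ M.closure (F ∪ C) := M.subset_closure_of_subset' Set.subset_union_right hC
  constructor
  · intro h
    constructor
    · rw [← h, Set.sdiff_union_of_subset hsub, closure_closure]
    · rw [← h]
      exact Set.disjoint_sdiff_left
  · rintro ⟨h, hd⟩
    rw [h, Set.union_sdiff_right, hd.sdiff_eq_left]

theorem natRank_eq_natRk_ground (M : Matroid α) : M.natRank = M.natRk M.E := by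
  rw [natRank, natRk, eRk_ground]

/-! ### Maps preserving and reflecting the closure -/

/-- `f` maps the ground set of `M` onto that of `N`, and it preserves and reflects membership in
the closure. Such a map induces an isomorphism of the lattices of flats. -/
structure IsClosureMap (f : α → β) (M : Matroid α) (N : Matroid β) : Prop where
  image_ground : f '' M.E = N.E
  mem_closure_iff : ∀ ⦃X⦄, X ⊆ M.E → ∀ ⦃a⦄, a ∈ M.E →
    (f a ∈ N.closure (f '' X) ↔ a ∈ M.closure X)

namespace IsClosureMap

variable {f : α → β} {M : Matroid α} {N : Matroid β}

theorem image_subset (h : IsClosureMap f M N) {X : Set α} (hX : X ⊆ M.E) : f '' X ⊆ N.E :=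
  h.image_ground ▸ Set.image_mono hX

theorem mem_of_map_mem (h : IsClosureMap f M N) {F : Set α} (hF : M.IsFlat F) {a : α}
    (ha : a ∈ M.E) (hfa : f a ∈ f '' F) : a ∈ F := by
  rw [← hF.closure, ← h.mem_closure_iff hF.subset_ground ha]
  exact N.mem_closure_of_mem hfa (h.image_subset hF.subset_ground)

theorem isFlat_image (h : IsClosureMap f M N) {F : Set α} (hF : M.IsFlat F) :
    N.IsFlat (f '' F) := by
  rw [isFlat_iff_closure_eq]
  refine (N.subset_closure _ (h.image_subset hF.subset_ground)).antisymm' fun b hb => ?_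
  obtain ⟨a, ha, rfl⟩ := h.image_ground.symm ▸ N.mem_ground_of_mem_closure hb
  rw [h.mem_closure_iff hF.subset_ground ha, hF.closure] at hb
  exact Set.mem_image_of_mem f hb

theorem exists_isFlat_image_eq (h : IsClosureMap f M N) {F : Set β} (hF : N.IsFlat F) :
    ∃ F', M.IsFlat F' ∧ f '' F' = F := by
  have him : f '' (M.E ∩ f ⁻¹' F) = F := by
    rw [Set.image_inter_preimage, h.image_ground, Set.inter_eq_right]
    exact hF.subset_ground
  refine ⟨M.E ∩ f ⁻¹' F, ?_, him⟩
  rw [isFlat_iff_closure_eq]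
  refine (M.subset_closure _ Set.inter_subset_left).antisymm' fun a ha => ?_
  have haE := M.mem_ground_of_mem_closure ha
  rw [← h.mem_closure_iff Set.inter_subset_left haE, him, hF.closure] at ha
  exact ⟨haE, ha⟩

theorem image_injOn_isFlat (h : IsClosureMap f M N) {F F' : Set α} (hF : M.IsFlat F)
    (hF' : M.IsFlat F') (heq : f '' F = f '' F') : F = F' :=
  Set.Subset.antisymm
    (fun _ ha => h.mem_of_map_mem hF' (hF.subset_ground ha) (heq ▸ Set.mem_image_of_mem f ha))
    (fun _ ha => h.mem_of_map_mem hF (hF'.subset_ground ha) (heq ▸ Set.mem_image_of_mem f ha))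

theorem contract (h : IsClosureMap f M N) {F : Set α} (hF : M.IsFlat F) :
    IsClosureMap f (M ／ F) (N ／ (f '' F)) where
  image_ground := by
    rw [contract_ground, contract_ground, ← h.image_ground]
    ext b
    constructor
    · rintro ⟨a, ha, rfl⟩
      exact ⟨⟨a, ha.1, rfl⟩, fun hfa => ha.2 (h.mem_of_map_mem hF ha.1 hfa)⟩
    · rintro ⟨⟨a, ha, rfl⟩, hb⟩
      exact ⟨a, ⟨ha, fun haF => hb ⟨a, haF, rfl⟩⟩, rfl⟩
  mem_closure_iff := by
    intro X hX a ha
    rw [contract_ground] at hX ha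
    rw [contract_closure_eq, contract_closure_eq, ← Set.image_union, Set.mem_sdiff, Set.mem_sdiff,
      h.mem_closure_iff (Set.union_subset (hX.trans Set.sdiff_subset) hF.subset_ground) ha.1]
    exact and_congr_right fun _ => iff_of_true (fun hfa => ha.2 (h.mem_of_map_mem hF ha.1 hfa)) ha.2

theorem loopless (h : IsClosureMap f M N) [M.Loopless] : N.Loopless := by
  refine ⟨Set.eq_empty_of_forall_notMem fun b hb => ?_⟩
  obtain ⟨a, ha, rfl⟩ := h.image_ground.symm ▸ N.mem_ground_of_mem_closure hb
  have := (h.mem_closure_iff (Set.empty_subset _) ha).1 (by rwa [Set.image_empty])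
  rw [closure_empty, loops_eq_empty] at this
  exact this

/-- The map need not be injective, but it is injective on independent sets: if two elements of one
had the same image, each would lie in the closure of the rest. A basis of `X` thus maps bijectively
to a basis of the image. -/
theorem eRk_image (h : IsClosureMap f M N) {X : Set α} (hX : X ⊆ M.E) :
    N.eRk (f '' X) = M.eRk X := by
  obtain ⟨I, hI⟩ := M.exists_isBasis X hX
  have hIE := hI.indep.subset_ground
  have hinj : Set.InjOn f I := by
    intro a ha b hb hab
    by_contra hne
    refine hI.indep.notMem_closure_sdiff_of_mem ha ?_
    rw [← h.mem_closure_iff (Set.sdiff_subset.trans hIE) (hIE ha), hab]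
    exact N.mem_closure_of_mem ⟨b, ⟨hb, fun h => hne h.symm⟩, rfl⟩
      (h.image_subset (Set.sdiff_subset.trans hIE))
  have hbas : N.IsBasis (f '' I) (f '' X) := by
    rw [isBasis_iff_indep_subset_closure]
    refine ⟨?_, Set.image_mono hI.subset, ?_⟩
    · rw [indep_iff_forall_notMem_closure_sdiff (h.image_subset hIE)]
      rintro _ ⟨a, ha, rfl⟩
      rw [← Set.image_singleton, ← hinj.image_sdiff_subset (Set.singleton_subset_iff.2 ha),
        h.mem_closure_iff (Set.sdiff_subset.trans hIE) (hIE ha)]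
      exact hI.indep.notMem_closure_sdiff_of_mem ha
    · rintro _ ⟨a, ha, rfl⟩
      rw [h.mem_closure_iff hIE (hX ha)]
      exact hI.subset_closure ha
  rw [← hbas.encard_eq_eRk, ← hI.encard_eq_eRk, hinj.encard_image]

theorem natRk_image (h : IsClosureMap f M N) {X : Set α} (hX : X ⊆ M.E) :
    N.natRk (f '' X) = M.natRk X := by
  rw [natRk, natRk, h.eRk_image hX]

theorem natRank_eq (h : IsClosureMap f M N) : N.natRank = M.natRank := by
  rw [natRank_eq_natRk_ground, natRank_eq_natRk_ground, ← h.image_ground, h.natRk_image subset_rfl]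

/-- Taking images is a rank-preserving bijection of flats, and `f` is again a closure map on the
contractions by corresponding flats, so the recursions agree term by term. -/
theorem klPoly_eq [Finite α] [Finite β] (h : IsClosureMap f M N) [M.Loopless] :
    klPoly M = klPoly N := by
  classical
  suffices H : ∀ n : ℕ, ∀ (M : Matroid α) (N : Matroid β), IsClosureMap f M N → M.Loopless →
      M.natRank = n → klPoly M = klPoly N from H _ M N h inferInstance rfl
  intro n
  induction n using Nat.strong_induction_on with
  | _ n ih =>
    intro M N h hM hn
    have hN := h.loopless
    have hK := isKLFamily_klPoly (α := β)
    refine klPoly_eq_of_isPal (fun h0 => hK.rank_zero N hN (h.natRank_eq.trans h0))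
      (fun h0 => h.natRank_eq ▸ hK.degree_lt N hN (h.natRank_eq ▸ h0)) ?_
    have hpal := hK.palindromic N hN
    rw [h.natRank_eq, zPoly_eq] at hpal
    convert hpal using 2
    refine Finset.sum_bij (fun F _ => f '' F) (fun F hF => ?_) (fun F hF F' hF' heq => ?_)
      (fun F hF => ?_) (fun F hF => ?_)
    · rw [Finset.mem_erase, mem_flats] at hF ⊢
      exact ⟨by simpa using hF.1, h.isFlat_image hF.2⟩
    · rw [Finset.mem_erase, mem_flats] at hF hF'
      exact h.image_injOn_isFlat hF.2 hF'.2 heq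
    · rw [Finset.mem_erase, mem_flats] at hF
      obtain ⟨F', hF', rfl⟩ := h.exists_isFlat_image_eq hF.2
      exact ⟨F', Finset.mem_erase.2 ⟨by simpa using hF.1, mem_flats.2 hF'⟩, rfl⟩
    · rw [Finset.mem_erase, mem_flats] at hF
      rw [h.natRk_image hF.2.subset_ground,
        ih _ (hn ▸ natRank_contract_lt hF.2 hF.1) _ _ (h.contract hF.2) (loopless_contract hF.2)
          rfl]

end IsClosureMap

/-! ### Direct sums -/

/-- `M` is the direct sum of `M₁` and `M₂`. -/
structure IsDirectSum (M M₁ M₂ : Matroid α) : Prop where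
  disjoint : Disjoint M₁.E M₂.E
  closure_eq : ∀ X, M.closure X = M₁.closure X ∪ M₂.closure X

namespace IsDirectSum

variable {M M₁ M₂ : Matroid α}

theorem symm (h : IsDirectSum M M₁ M₂) : IsDirectSum M M₂ M₁ :=
  ⟨h.disjoint.symm, fun X => by rw [h.closure_eq, Set.union_comm]⟩

theorem ground_eq (h : IsDirectSum M M₁ M₂) : M.E = M₁.E ∪ M₂.E := by
  simpa using h.closure_eq Set.univ

theorem closure_inter_left (h : IsDirectSum M M₁ M₂) (X : Set α) :
    M.closure X ∩ M₁.E = M₁.closure X := by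
  rw [h.closure_eq, Set.union_inter_distrib_right,
    Set.inter_eq_left.2 (M₁.closure_subset_ground X),
    (h.disjoint.symm.mono_left (M₂.closure_subset_ground X)).inter_eq, Set.union_empty]

/-- Both summands are contracted by the whole of `F`, which need not lie in either ground set;
closures ignore the excess, so no intersections have to be carried along. -/
theorem contract (h : IsDirectSum M M₁ M₂) (F : Set α) :
    IsDirectSum (M ／ F) (M₁ ／ F) (M₂ ／ F) :=
  ⟨h.disjoint.mono Set.sdiff_subset Set.sdiff_subset, fun X => by
    simp only [contract_closure_eq, h.closure_eq, Set.union_sdiff_distrib]⟩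

theorem loopless_left (h : IsDirectSum M M₁ M₂) [M.Loopless] : M₁.Loopless := by
  refine ⟨?_⟩
  rw [← closure_empty, ← h.closure_inter_left, closure_empty, loops_eq_empty, Set.empty_inter]

theorem isFlat_inter_left (h : IsDirectSum M M₁ M₂) {F : Set α} (hF : M.IsFlat F) :
    M₁.IsFlat (F ∩ M₁.E) := by
  rw [isFlat_iff_closure_eq, closure_inter_ground, ← h.closure_inter_left, hF.closure]

theorem isFlat_union (h : IsDirectSum M M₁ M₂) {F₁ F₂ : Set α} (h₁ : M₁.IsFlat F₁)
    (h₂ : M₂.IsFlat F₂) : M.IsFlat (F₁ ∪ F₂) := by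
  have e₁ : (F₁ ∪ F₂) ∩ M₁.E = F₁ := by
    rw [Set.union_inter_distrib_right, Set.inter_eq_left.2 h₁.subset_ground,
      (h.disjoint.symm.mono_left h₂.subset_ground).inter_eq, Set.union_empty]
  have e₂ : (F₁ ∪ F₂) ∩ M₂.E = F₂ := by
    rw [Set.union_inter_distrib_right, Set.inter_eq_left.2 h₂.subset_ground,
      (h.disjoint.mono_left h₁.subset_ground).inter_eq, Set.empty_union]
  rw [isFlat_iff_closure_eq, h.closure_eq, ← M₁.closure_inter_ground, ← M₂.closure_inter_ground,
    e₁, e₂, h₁.closure, h₂.closure]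

theorem indep_inter_left (h : IsDirectSum M M₁ M₂) {I : Set α} (hI : M.Indep I) :
    M₁.Indep (I ∩ M₁.E) := by
  rw [indep_iff_forall_notMem_closure_sdiff Set.inter_subset_right]
  intro a ha hcl
  refine hI.notMem_closure_sdiff_of_mem ha.1 ?_
  rw [h.closure_eq]
  exact Or.inl (M₁.closure_subset_closure (Set.sdiff_subset_sdiff_left Set.inter_subset_left) hcl)

theorem natRk_eq [Finite α] (h : IsDirectSum M M₁ M₂) {X : Set α} (hX : X ⊆ M.E) :
    M.natRk X = M₁.natRk X + M₂.natRk X := by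
  obtain ⟨I, hI⟩ := M.exists_isBasis X hX
  have key {N N' : Matroid α} (h : IsDirectSum M N N') : N.eRk X = (I ∩ N.E).encard := by
    have : N.IsBasis (I ∩ N.E) (X ∩ N.E) := by
      rw [isBasis_iff_indep_subset_closure]
      refine ⟨h.indep_inter_left hI.indep, Set.inter_subset_inter_left _ hI.subset, ?_⟩
      rw [closure_inter_ground, ← h.closure_inter_left]
      exact Set.inter_subset_inter_left _ hI.subset_closure
    rw [this.encard_eq_eRk, eRk_inter_ground]
  rw [natRk, natRk, natRk, key h, key h.symm, ← hI.encard_eq_eRk, ← ENat.toNat_add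
    (Set.toFinite _).encard_lt_top.ne (Set.toFinite _).encard_lt_top.ne, ← Set.encard_union_eq
    (h.disjoint.mono Set.inter_subset_right Set.inter_subset_right), ← Set.inter_union_distrib_left,
    ← h.ground_eq, Set.inter_eq_left.2 hI.indep.subset_ground]

theorem natRk_ground_left (h : IsDirectSum M M₁ M₂) : M₁.natRk M.E = M₁.natRank := by
  rw [natRk, natRank, eRk_eq_eRank (h.ground_eq ▸ Set.subset_union_left)]

theorem natRank_eq [Finite α] (h : IsDirectSum M M₁ M₂) :
    M.natRank = M₁.natRank + M₂.natRank := by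
  rw [natRank_eq_natRk_ground, h.natRk_eq subset_rfl, h.natRk_ground_left, h.symm.natRk_ground_left]

/-- The flats of a direct sum are exactly the unions of a flat of each summand, and their ranks add.
-/
theorem zPoly_mul [Finite α] (h : IsDirectSum M M₁ M₂) (P : Matroid α → ℤ[X]) :
    zPoly P M₁ * zPoly P M₂ =
      ∑ F ∈ M.flats, X ^ M.natRk F * (P (M₁ ／ F) * P (M₂ ／ F)) := by
  rw [zPoly, zPoly, Finset.sum_mul_sum, ← Finset.sum_product']
  symm
  refine Finset.sum_bij' (fun F _ => (F ∩ M₁.E, F ∩ M₂.E)) (fun p _ => p.1 ∪ p.2)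
    (fun F hF => ?_) (fun p hp => ?_) (fun F hF => ?_) (fun p hp => ?_) (fun F hF => ?_)
  · rw [mem_flats] at hF
    exact Finset.mem_product.2 ⟨mem_flats.2 (h.isFlat_inter_left hF),
      mem_flats.2 (h.symm.isFlat_inter_left hF)⟩
  · rw [Finset.mem_product, mem_flats, mem_flats] at hp
    exact mem_flats.2 (h.isFlat_union hp.1 hp.2)
  · rw [mem_flats] at hF
    simp only [← Set.inter_union_distrib_left, ← h.ground_eq]
    exact Set.inter_eq_left.2 hF.subset_ground
  · rw [Finset.mem_product, mem_flats, mem_flats] at hp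
    have h₁ := hp.1.subset_ground
    have h₂ := hp.2.subset_ground
    refine Prod.ext ?_ ?_
    · simp only [Set.union_inter_distrib_right, Set.inter_eq_left.2 h₁,
        (h.disjoint.symm.mono_left h₂).inter_eq, Set.union_empty]
    · simp only [Set.union_inter_distrib_right, Set.inter_eq_left.2 h₂,
        (h.disjoint.mono_left h₁).inter_eq, Set.empty_union]
  · rw [mem_flats] at hF
    simp only [contract_inter_ground_eq]
    rw [h.natRk_eq hF.subset_ground, natRk, natRk, natRk, natRk, eRk_inter_ground,
      eRk_inter_ground, pow_add]
    ring

/-- The product of the two `Z`-polynomials is palindromic. By induction, its terms at nonempty flats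
are those of `M`, so its term at `∅` must be the polynomial of `M`. -/
theorem klPoly_eq [Finite α] (h : IsDirectSum M M₁ M₂) [M.Loopless] :
    klPoly M = klPoly M₁ * klPoly M₂ := by
  classical
  suffices H : ∀ n : ℕ, ∀ M M₁ M₂ : Matroid α, IsDirectSum M M₁ M₂ → M.Loopless →
      M.natRank = n → klPoly M = klPoly M₁ * klPoly M₂ from H _ M M₁ M₂ h inferInstance rfl
  intro n
  induction n using Nat.strong_induction_on with
  | _ n ih =>
    intro M M₁ M₂ h hM hn
    have hM₁ := h.loopless_left
    have hM₂ := h.symm.loopless_left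
    have hK := isKLFamily_klPoly (α := α)
    have hr := h.natRank_eq
    refine klPoly_eq_of_isPal (fun h0 => ?_) (fun h0 => ?_) ?_
    · rw [hK.rank_zero M₁ hM₁ (by omega), hK.rank_zero M₂ hM₂ (by omega), mul_one]
    -- The weak bounds add up; the result is strict because at least one summand has positive rank.
    · have hle := natDegree_mul_le (p := klPoly M₁) (q := klPoly M₂)
      have h₁ := two_mul_natDegree_klPoly_le M₁
      have h₂ := two_mul_natDegree_klPoly_le M₂
      have h₁' := hK.degree_lt M₁ hM₁
      have h₂' := hK.degree_lt M₂ hM₂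
      omega
    · have hpal := (hK.palindromic M₁ hM₁).mul (hK.palindromic M₂ hM₂)
      rw [← hr, h.zPoly_mul, ← Finset.add_sum_erase _ _ M.empty_mem_flats] at hpal
      convert hpal using 2
      · simp [natRk]
      · refine Finset.sum_congr rfl fun F hF => ?_
        rw [Finset.mem_erase, mem_flats] at hF
        rw [ih _ (hn ▸ natRank_contract_lt hF.2 hF.1) _ _ _ (h.contract F)
          (loopless_contract hF.2) rfl]

end IsDirectSum

/-! ### Deletion of an element -/

theorem deleteElem_isFlat_iff {M : Matroid α} {e : α} {F : Set α} :
    (M ＼ {e}).IsFlat F ↔ M.closure F \ {e} = F := by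
  rw [isFlat_iff_closure_eq, delete_closure_eq]
  constructor <;> intro h
  · have he : e ∉ F := fun he => (h.symm ▸ he : e ∈ M.closure (F \ {e}) \ {e}).2 rfl
    rwa [Set.sdiff_singleton_eq_self he] at h
  · have he : e ∉ F := fun he => (h.symm ▸ he : e ∈ M.closure F \ {e}).2 rfl
    rwa [Set.sdiff_singleton_eq_self he]

theorem natRk_deleteElem {M : Matroid α} {e : α} {F : Set α} (he : e ∉ F) :
    (M ＼ {e}).natRk F = M.natRk F := by
  rw [natRk, natRk, delete_eq_restrict, restrict_eRk_eq', ← Set.inter_sdiff_assoc,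
    Set.sdiff_singleton_eq_self (fun h => he h.1), eRk_inter_ground]

theorem natRank_deleteElem {M : Matroid α} {e : α} (he : ¬ M.IsColoop e) :
    (M ＼ {e}).natRank = M.natRank := by
  rw [isColoop_iff_sdiff_closure, not_not] at he
  rw [natRank, natRank, delete_eq_restrict, eRank_restrict, ← eRk_closure_eq, he, eRk_ground]

theorem loopless_delete {M : Matroid α} [M.Loopless] (D : Set α) : (M ＼ D).Loopless :=
  ⟨by rw [delete_loops_eq, loops_eq_empty, Set.empty_sdiff]⟩

/-- Deleting an element that is parallel to another one does not change the lattice of flats. -/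
theorem klPoly_deleteElem_of_not_isFlat [Finite α] {M : Matroid α} [M.Loopless] {e : α}
    (he : e ∈ M.E) (hflat : ¬ M.IsFlat {e}) : klPoly (M ＼ {e}) = klPoly M := by
  classical
  obtain ⟨g, hg, hge⟩ : ∃ g ∈ M.closure {e}, g ≠ e := by
    by_contra! hcon
    refine hflat (isFlat_iff_closure_eq.2 (Set.Subset.antisymm hcon ?_))
    exact M.subset_closure _ (Set.singleton_subset_iff.2 he)
  have hgE := M.mem_ground_of_mem_closure hg
  have heg : M.closure {g} = M.closure {e} :=
    (isNonloop_of_loopless hgE).closure_eq_of_mem_closure hg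
  -- Replacing `e` by the parallel element `g` and fixing everything else is the closure map from
  -- `M` to the deletion.
  have hf (a : α) : M.closure {Function.update id e g a} = M.closure {a} := by
    rcases eq_or_ne a e with rfl | ha
    · simpa using heg
    · simp [ha]
  have hfe (a : α) : Function.update id e g a ≠ e := by
    rcases eq_or_ne a e with rfl | ha
    · simpa using hge
    · simp [ha]
  have hfE {a : α} (ha : a ∈ M.E) : Function.update id e g a ∈ M.E := by
    rcases eq_or_ne a e with rfl | hae
    · simpa using hgE
    · simpa [hae] using ha
  have hcl (X : Set α) : M.closure (Function.update id e g '' X) = M.closure X := by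
    have h1 := M.closure_biUnion_congr (fun a => {Function.update id e g a}) (fun a => {a}) X
      (fun a _ => hf a)
    rwa [Set.biUnion_of_singleton, ← Set.image_eq_iUnion] at h1
  refine (IsClosureMap.klPoly_eq (f := Function.update id e g) ⟨?_, ?_⟩).symm
  · ext b
    constructor
    · rintro ⟨a, ha, rfl⟩
      exact ⟨hfE ha, hfe a⟩
    · rintro ⟨hb, hbe⟩
      exact ⟨b, hb, Function.update_of_ne hbe g id⟩
  · intro X hX a ha
    have hX' : e ∉ Function.update id e g '' X := fun ⟨b, _, hb⟩ => hfe b hb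
    rw [delete_closure_eq, Set.sdiff_singleton_eq_self hX', hcl, Set.mem_sdiff,
      and_iff_left (show _ ∉ ({e} : Set α) from hfe a)]
    have hiff (b : α) (hb : b ∈ M.E) : b ∈ M.closure X ↔ M.closure {b} ⊆ M.closure X := by
      rw [closure_subset_closure_iff_subset_closure (Set.singleton_subset_iff.2 hb),
        Set.singleton_subset_iff]
    rw [hiff _ (hfE ha), hiff _ ha, hf]

theorem natRk_insert [Finite α] {M : Matroid α} {e : α} {F : Set α} (he : e ∈ M.E)
    (heF : e ∉ M.closure F) : M.natRk (insert e F) = M.natRk F + 1 := by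
  rw [natRk, natRk, eRk_insert_eq_add_one ⟨he, heF⟩, ENat.toNat_add _ (by simp)]
  · simp
  · exact ((M.eRk_le_encard F).trans_lt (Set.toFinite F).encard_lt_top).ne

/-- The flats of `M ＼ {e}` whose closure in `M` contains `e`. -/
theorem sum_flats_deleteElem_of_mem_closure [Finite α] {M : Matroid α} {e : α}
    (P : Matroid α → ℤ[X]) [DecidablePred fun F => e ∈ M.closure F]
    [DecidablePred fun F : Set α => e ∈ F] [DecidablePred fun F => e ∈ M.closure (F \ {e})] :
    ∑ F ∈ (M ＼ {e}).flats with e ∈ M.closure F,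
      X ^ (M ＼ {e}).natRk F * P (M ＼ {e} ／ F) =
    ∑ F ∈ M.flats.filter (fun F => e ∈ F) with e ∈ M.closure (F \ {e}),
      X ^ M.natRk F * P (M ／ F) := by
  have key {F : Set α} (hF : M.closure F \ {e} = F) (hcl : e ∈ M.closure F) :
      e ∉ F ∧ insert e F = M.closure F ∧ insert e F \ {e} = F := by
    have heF : e ∉ F := fun h => (hF.symm ▸ h : e ∈ M.closure F \ {e}).2 rfl
    refine ⟨heF, ?_, by simp [heF]⟩
    conv_lhs => rw [← hF]
    rw [Set.insert_sdiff_singleton, Set.insert_eq_of_mem hcl]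
  refine Finset.sum_bij' (fun F _ => insert e F) (fun F _ => F \ {e})
    (fun F hF => ?_) (fun F hF => ?_) (fun F hF => ?_) (fun F hF => ?_) (fun F hF => ?_)
  · rw [Finset.mem_filter, mem_flats, deleteElem_isFlat_iff] at hF
    obtain ⟨h1, h2, h3⟩ := key hF.1 hF.2
    rw [Finset.mem_filter, Finset.mem_filter, mem_flats]
    refine ⟨⟨?_, Set.mem_insert e F⟩, h3.symm ▸ hF.2⟩
    rw [h2]
    exact isFlat_closure F
  · rw [Finset.mem_filter, Finset.mem_filter, mem_flats] at hF
    rw [Finset.mem_filter, mem_flats, deleteElem_isFlat_iff]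
    refine ⟨?_, hF.2⟩
    rw [closure_sdiff_singleton_eq_closure hF.2, hF.1.1.closure]
  · rw [Finset.mem_filter, mem_flats, deleteElem_isFlat_iff] at hF
    exact (key hF.1 hF.2).2.2
  · rw [Finset.mem_filter, Finset.mem_filter] at hF
    rw [Set.insert_sdiff_singleton, Set.insert_eq_of_mem hF.1.2]
  · rw [Finset.mem_filter, mem_flats, deleteElem_isFlat_iff] at hF
    obtain ⟨h1, h2, h3⟩ := key hF.1 hF.2
    -- Since `e` is a loop of `M ／ F`, deleting it there is the same as contracting it.
    have hloop : {e} ⊆ (M ／ F).loops := by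
      rw [contract_loops_eq]
      exact Set.singleton_subset_iff.2 ⟨hF.2, h1⟩
    rw [natRk_deleteElem h1, ← contract_delete_comm _ (Set.disjoint_singleton_right.2 h1),
      ← contract_eq_delete_of_subset_loops hloop, contract_contract, Set.union_singleton]
    congr 2
    rw [natRk, natRk, h2, eRk_closure_eq]

/-- The flats `F` containing `e` in which `e` is a coloop. -/
theorem sum_flats_of_notMem_closure [Finite α] {M : Matroid α} {e : α} (he : e ∈ M.E)
    (P : Matroid α → ℤ[X]) [DecidablePred fun F : Set α => e ∈ F]
    [DecidablePred fun F => e ∈ M.closure (F \ {e})]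
    [DecidablePred fun F => M.IsFlat (insert e F)] :
    ∑ F ∈ M.flats.filter (fun F => e ∈ F) with e ∉ M.closure (F \ {e}),
      X ^ M.natRk F * P (M ／ F) =
    ∑ F ∈ M.flats.filter (fun F => e ∉ F) with M.IsFlat (insert e F),
      X ^ (M.natRk F + 1) * P (M ／ (insert e F)) := by
  have hins {F : Set α} (h : e ∈ F) : insert e (F \ {e}) = F := by
    rw [Set.insert_sdiff_singleton, Set.insert_eq_of_mem h]
  symm
  refine Finset.sum_bij' (fun F _ => insert e F) (fun F _ => F \ {e})
    (fun F hF => ?_) (fun F hF => ?_) (fun F hF => ?_) (fun F hF => ?_) (fun F hF => ?_)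
  · rw [Finset.mem_filter, Finset.mem_filter, mem_flats] at hF ⊢
    refine ⟨⟨hF.2, Set.mem_insert e F⟩, ?_⟩
    rw [Set.insert_sdiff_self_of_notMem hF.1.2, hF.1.1.closure]
    exact hF.1.2
  · rw [Finset.mem_filter, Finset.mem_filter, mem_flats] at hF ⊢
    refine ⟨⟨?_, fun h => h.2 rfl⟩, (hins hF.1.2).symm ▸ hF.1.1⟩
    rw [isFlat_iff_closure_eq]
    refine (M.subset_closure _ (Set.sdiff_subset.trans hF.1.1.subset_ground)).antisymm' ?_
    refine fun a ha => ⟨?_, fun hae => hF.2 (hae ▸ ha)⟩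
    rw [← hF.1.1.closure]
    exact M.closure_subset_closure Set.sdiff_subset ha
  · rw [Finset.mem_filter, Finset.mem_filter] at hF
    exact Set.insert_sdiff_self_of_notMem hF.1.2
  · rw [Finset.mem_filter, Finset.mem_filter] at hF
    exact hins hF.1.2
  · rw [Finset.mem_filter, Finset.mem_filter, mem_flats] at hF
    rw [natRk_insert he (by rw [hF.1.1.closure]; exact hF.1.2)]

open Classical in
/-- Suppose that the Kazhdan--Lusztig polynomials of the contractions `M ／ (insert e F)` never
attain the largest degree that is possible. Then the deletion formula for Kazhdan--Lusztig
polynomials has no correction terms. -/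
theorem klPoly_eq_deleteElem_sub [Finite α] (M : Matroid α) [M.Loopless] {e : α} (he : e ∈ M.E)
    (hcol : ¬ M.IsColoop e) (hflat : M.IsFlat {e})
    (hdeg : ∀ F, M.IsFlat F → e ∉ F → M.IsFlat (insert e F) →
      2 * (klPoly (M ／ (insert e F))).natDegree + 1 < (M ／ (insert e F)).natRank) :
    klPoly M = klPoly (M ＼ {e}) - X * klPoly (M ／ {e}) := by
  suffices H : ∀ n : ℕ, ∀ M : Matroid α, M.Loopless → e ∈ M.E → ¬ M.IsColoop e → M.IsFlat {e} →
      (∀ F, M.IsFlat F → e ∉ F → M.IsFlat (insert e F) →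
        2 * (klPoly (M ／ (insert e F))).natDegree + 1 < (M ／ (insert e F)).natRank) →
      M.natRank = n → klPoly M = klPoly (M ＼ {e}) - X * klPoly (M ／ {e}) from
    H _ M inferInstance he hcol hflat hdeg rfl
  intro n
  induction n using Nat.strong_induction_on with
  | _ n ih =>
    intro M hM he hcol hflat hdeg hn
    have hK := isKLFamily_klPoly (α := α)
    have hMe : (M ＼ {e}).Loopless := loopless_delete _
    have hrk := natRank_deleteElem hcol
    have hpos : 0 < M.natRank := by
      have := M.natRank_contract_add hflat
      have := natRk_pos hflat (Set.singleton_ne_empty e)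
      omega
    refine klPoly_eq_of_isPal (fun h0 => by omega) (fun _ => ?_) ?_
    -- The case `F = ∅` of `hdeg` leaves just enough room for the factor `X`, since contracting `e`
    -- lowers the rank by at least one.
    · have h1 := hK.degree_lt _ hMe (by omega)
      have h2 := hdeg ∅ (mem_flats.1 M.empty_mem_flats) (Set.notMem_empty e)
        (by simpa using hflat)
      rw [insert_empty_eq] at h2
      have h3 := M.natRank_contract_add hflat
      have h4 := natRk_pos hflat (Set.singleton_ne_empty e)
      have h5 := natDegree_sub_le (klPoly (M ＼ {e})) (X * klPoly (M ／ {e}))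
      have h6 := natDegree_mul_le (p := (X : ℤ[X])) (q := klPoly (M ／ {e}))
      rw [natDegree_X] at h6
      omega
    have hpal := hK.palindromic _ hMe
    rw [hrk] at hpal
    convert hpal using 1
    -- If `insert e F` is a flat, this is the induction hypothesis for `M ／ F`. Otherwise `e` is
    -- parallel to another element of `M ／ F`, and deleting it changes nothing.
    have hterm (F : Set α) (hF : M.IsFlat F) (heF : e ∉ F) (hne : F ≠ ∅) :
        klPoly (M ／ F) = klPoly (M ＼ {e} ／ F) -
          if M.IsFlat (insert e F) then X * klPoly (M ／ (insert e F)) else 0 := by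
      have hFE := hF.subset_ground
      have hloop := loopless_contract hF
      have hiff : M.IsFlat (insert e F) ↔ (M ／ F).IsFlat {e} := by
        rw [contract_isFlat_iff hFE, Set.singleton_union, Set.disjoint_singleton_left,
          and_iff_left heF]
      rw [← contract_delete_comm _ (Set.disjoint_singleton_right.2 heF)]
      split_ifs with hins
      · rw [ih _ (hn ▸ natRank_contract_lt hF hne) (M ／ F) hloop ⟨he, heF⟩
          (fun h => hcol (contract_isColoop_iff.1 h).1) (hiff.1 hins) ?_ rfl, contract_contract,
          Set.union_singleton]
        -- The degree hypothesis passes to `M ／ F` because flats of `M ／ F` are flats of `M`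
        -- containing `F`, with `F` removed.
        intro F' hF' heF' hins'
        rw [contract_isFlat_iff hFE] at hF' hins'
        have := hdeg (F' ∪ F) hF'.1 (by simp [heF, heF'])
          (by rw [← Set.insert_union]; exact hins'.1)
        rwa [contract_contract, Set.union_comm, Set.insert_union]
      · rw [klPoly_deleteElem_of_not_isFlat (M := M ／ F) ⟨he, heF⟩ (hiff.not.1 hins), sub_zero]
    rw [zPoly, ← Finset.sum_filter_add_sum_filter_not (M ＼ {e}).flats (fun F => e ∈ M.closure F),
      sum_flats_deleteElem_of_mem_closure klPoly]
    -- The flats of the deletion whose closure contains `e` match the flats of `M` in which `e` is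
    -- present but not a coloop; the others are the flats of `M` avoiding `e`.
    have hT : (M ＼ {e}).flats.filter (fun F => e ∉ M.closure F) =
        M.flats.filter (fun F => e ∉ F) := by
      ext F
      rw [Finset.mem_filter, Finset.mem_filter, mem_flats, mem_flats, deleteElem_isFlat_iff]
      constructor
      · rintro ⟨h1, h2⟩
        rw [Set.sdiff_singleton_eq_self h2] at h1
        exact ⟨isFlat_iff_closure_eq.2 h1, h1 ▸ h2⟩
      · rintro ⟨h1, h2⟩
        rw [h1.closure]
        exact ⟨Set.sdiff_singleton_eq_self h2, h2⟩
    rw [hT]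
    have h0 : ∅ ∈ M.flats.filter (fun F => e ∉ F) :=
      Finset.mem_filter.2 ⟨M.empty_mem_flats, Set.notMem_empty e⟩
    have hsplit : ∑ F ∈ M.flats.erase ∅, X ^ M.natRk F * klPoly (M ／ F) =
        ∑ F ∈ (M.flats.filter (fun F => e ∉ F)).erase ∅, X ^ M.natRk F * klPoly (M ／ F) +
        ∑ F ∈ M.flats.filter (fun F => e ∈ F), X ^ M.natRk F * klPoly (M ／ F) := by
      rw [← Finset.sum_filter_add_sum_filter_not (M.flats.erase ∅) (fun F => e ∉ F),
        Finset.filter_erase, Finset.filter_erase]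
      congr 2
      simp
    rw [hsplit, ← Finset.sum_filter_add_sum_filter_not (M.flats.filter (fun F => e ∈ F))
      (fun F => e ∈ M.closure (F \ {e})), sum_flats_of_notMem_closure he klPoly,
      Finset.sum_filter (s := M.flats.filter (fun F => e ∉ F)),
      ← Finset.add_sum_erase _ _ h0, ← Finset.add_sum_erase _ _ h0]
    have hsum : ∑ F ∈ (M.flats.filter (fun F => e ∉ F)).erase ∅, X ^ M.natRk F * klPoly (M ／ F) =
        ∑ F ∈ (M.flats.filter (fun F => e ∉ F)).erase ∅,
          X ^ (M ＼ {e}).natRk F * klPoly (M ＼ {e} ／ F) -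
        ∑ F ∈ (M.flats.filter (fun F => e ∉ F)).erase ∅,
          if M.IsFlat (insert e F) then X ^ (M.natRk F + 1) * klPoly (M ／ (insert e F)) else 0 := by
      rw [← Finset.sum_sub_distrib]
      refine Finset.sum_congr rfl fun F hF => ?_
      rw [Finset.mem_erase, Finset.mem_filter, mem_flats] at hF
      rw [hterm F hF.2.1 hF.2.2 hF.1, natRk_deleteElem hF.2.2]
      split_ifs <;> ring
    have hempty : M.natRk ∅ = 0 := by simp [natRk]
    -- The flats of `M` in which `e` is a coloop cancel the subtracted terms: `{e}` cancels `X *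
    -- klPoly (M ／ {e})` from the candidate, and the others cancel the corrections in `hsum`.
    rw [hsum, natRk_deleteElem (Set.notMem_empty e), hempty, insert_empty_eq, if_pos hflat,
      contract_empty]
    ring

end Matroid

open scoped Matroid

namespace SimpleGraph

variable {V W : Type*}

/-! ### The closure in a graphic matroid -/

/-- Weaker than a graph homomorphism: an edge may collapse to a vertex or be replaced by a path. The
comparisons of graphic closures below rest on such vertex maps. -/
theorem Reachable.map_of_forall_adj {G : SimpleGraph V} {H : SimpleGraph W} (f : V → W)
    (h : ∀ a b, G.Adj a b → H.Reachable (f a) (f b)) {a b : V} (hab : G.Reachable a b) :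
    H.Reachable (f a) (f b) := by
  obtain ⟨p⟩ := hab
  induction p with
  | nil => exact Reachable.refl _
  | cons hadj _ ih => exact (h _ _ hadj).trans ih

theorem fromEdgeSet_reachable_of_mem {S : Set (Sym2 V)} {a b : V} (h : s(a, b) ∈ S) :
    (fromEdgeSet S).Reachable a b := by
  rcases eq_or_ne a b with rfl | hne
  · exact Reachable.refl _
  · exact Adj.reachable ((fromEdgeSet_adj S).2 ⟨h, hne⟩)

theorem graphicMatroid_ground [Finite V] (G : SimpleGraph V) : G.graphicMatroid.E = G.edgeSet := rfl

theorem graphicMatroid_indep_iff [Finite V] {G : SimpleGraph V} {I : Set (Sym2 V)} :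
    G.graphicMatroid.Indep I ↔ I ⊆ G.edgeSet ∧ (fromEdgeSet I).IsAcyclic := Iff.rfl

/-- For a spanning forest of `X`, adding an edge creates a cycle exactly when its ends are already
joined. -/
theorem mem_closure_graphicMatroid_iff [Finite V] {G : SimpleGraph V} {X : Set (Sym2 V)}
    (hX : X ⊆ G.edgeSet) {u v : V} (huv : G.Adj u v) :
    s(u, v) ∈ G.graphicMatroid.closure X ↔ (fromEdgeSet X).Reachable u v := by
  obtain ⟨I, hI⟩ := G.graphicMatroid.exists_isBasis X hX
  have hcl {a b : V} (hab : G.Adj a b) :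
      s(a, b) ∈ G.graphicMatroid.closure X ↔ (fromEdgeSet I).Reachable a b := by
    rw [← hI.closure_eq_closure, hI.indep.mem_closure_iff', graphicMatroid_ground,
      and_iff_right (show s(a, b) ∈ G.edgeSet from hab), graphicMatroid_indep_iff,
      ← Set.union_singleton, fromEdgeSet_union, ← edge, isAcyclic_sup_fromEdgeSet_iff]
    constructor
    · intro h
      by_contra hr
      exact hr (fromEdgeSet_reachable_of_mem (h ⟨Set.union_subset hI.indep.subset_ground
        (Set.singleton_subset_iff.2 hab), hI.indep.2, fun h => absurd h hr⟩))
    · rintro hr ⟨-, -, h⟩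
      rcases h hr with h | h
      · exact absurd h hab.ne
      · exact ((fromEdgeSet_adj I).1 h).1
  rw [hcl huv]
  refine ⟨fun h => h.mono (fromEdgeSet_mono hI.subset), fun h => ?_⟩
  -- Every edge of `X` lies in the closure of `X`, so its ends are joined within the basis `I`;
  -- walks in `X` are replaced edge by edge.
  refine h.map_of_forall_adj id fun a b hab => ?_
  have hmem := ((fromEdgeSet_adj X).1 hab).1
  exact (hcl (hX hmem)).1 (G.graphicMatroid.mem_closure_of_mem hmem hX)

instance loopless_graphicMatroid [Finite V] (G : SimpleGraph V) : G.graphicMatroid.Loopless := by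
  refine ⟨Set.eq_empty_of_forall_notMem fun a ha => ?_⟩
  have haE : a ∈ G.edgeSet := G.graphicMatroid.mem_ground_of_mem_closure ha
  induction a with
  | _ u v =>
    have h := (mem_closure_graphicMatroid_iff (Set.empty_subset _) haE).1 ha
    rw [fromEdgeSet_empty, reachable_bot] at h
    exact G.ne_of_adj haE h

theorem isFlat_singleton_graphicMatroid [Finite V] {G : SimpleGraph V} {x y : V} (e : G.Adj x y) :
    G.graphicMatroid.IsFlat {s(x, y)} := by
  classical
  have hsub : {s(x, y)} ⊆ G.graphicMatroid.E := Set.singleton_subset_iff.2 e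
  rw [Matroid.isFlat_iff_closure_eq]
  refine (G.graphicMatroid.subset_closure _ hsub).antisymm' fun a ha => ?_
  have haE : a ∈ G.edgeSet := G.graphicMatroid.mem_ground_of_mem_closure ha
  induction a with
  | _ u v =>
    rw [mem_closure_graphicMatroid_iff hsub haE] at ha
    -- Collapsing `y` to `x` destroys the only edge, so joined vertices acquire equal images;
    -- distinct ones can only be `x` and `y`.
    have hr : (⊥ : SimpleGraph V).Reachable (if u = y then x else u) (if v = y then x else v) := by
      refine ha.map_of_forall_adj (fun a => if a = y then x else a) fun a b hab => ?_
      rw [fromEdgeSet_adj, Set.mem_singleton_iff] at hab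
      rw [reachable_bot]
      grind
    rw [reachable_bot] at hr
    have := G.ne_of_adj haE
    rw [Set.mem_singleton_iff]
    grind

theorem graphicMatroid_deleteEdges [Finite V] (G : SimpleGraph V) (D : Set (Sym2 V)) :
    (G.deleteEdges D).graphicMatroid = G.graphicMatroid ＼ D := by
  refine Matroid.ext_indep (G.edgeSet_deleteEdges D) fun I _ => ?_
  rw [Matroid.delete_indep_iff, graphicMatroid_indep_iff, graphicMatroid_indep_iff,
    edgeSet_deleteEdges, Set.subset_sdiff]
  tauto

/-! ### Contraction of an edge of a subgraph -/

namespace Subgraph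

variable {G : SimpleGraph V} (H : G.Subgraph) {x y : V}

/-- The contraction by the edge `xy` of the restriction of the graphic matroid of `G` to the
subgraph `H`. -/
def contractMatroid [Finite V] (x y : V) : Matroid (Sym2 V) :=
  (G.graphicMatroid ／ {s(x, y)}) ↾ (H.edgeSet \ {s(x, y)})

theorem sdiff_subset_ground_contract [Finite V] :
    H.edgeSet \ {s(x, y)} ⊆ (G.graphicMatroid ／ {s(x, y)}).E :=
  Set.sdiff_subset_sdiff_left H.edgeSet_subset

theorem contractMatroid_ground [Finite V] : (H.contractMatroid x y).E = H.edgeSet \ {s(x, y)} := rfl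

theorem closure_contractMatroid [Finite V] (X : Set (Sym2 V)) :
    (H.contractMatroid x y).closure X =
      G.graphicMatroid.closure (insert s(x, y) (X ∩ (H.edgeSet \ {s(x, y)}))) ∩
        (H.edgeSet \ {s(x, y)}) := by
  rw [contractMatroid, Matroid.restrict_closure_eq',
    Set.sdiff_eq_empty.2 H.sdiff_subset_ground_contract, Set.union_empty,
    Matroid.contract_closure_eq, Set.union_singleton, Set.inter_comm, ← Set.inter_sdiff_assoc,
    Set.inter_comm, Set.inter_sdiff_assoc, Set.sdiff_sdiff, Set.union_self]

open Classical in
/-- The map from the vertices of `G` onto those of `H / xy`. -/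
noncomputable def toContractEdge {H : G.Subgraph} (e : H.Adj x y) (v : V) :
    Quot fun a b : H.verts => a = ⟨x, e.fst_mem⟩ ∧ b = ⟨y, e.snd_mem⟩ :=
  if h : v ∈ H.verts then Quot.mk _ ⟨v, h⟩ else Quot.mk _ ⟨x, e.fst_mem⟩

open Classical in
/-- The section of the projection onto the vertices of `H / xy` whose values are not `y`. -/
noncomputable def ofContractEdge {H : G.Subgraph} (e : H.Adj x y) :
    (Quot fun a b : H.verts => a = ⟨x, e.fst_mem⟩ ∧ b = ⟨y, e.snd_mem⟩) → V :=
  Quot.lift (fun a => if a.1 = y then x else a.1) (by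
    rintro _ _ ⟨rfl, rfl⟩
    simp [e.ne])

variable {H}

theorem toContractEdge_of_mem (e : H.Adj x y) {v : V} (h : v ∈ H.verts) :
    toContractEdge e v = Quot.mk _ ⟨v, h⟩ := dif_pos h

open Classical in
theorem ofContractEdge_toContractEdge (e : H.Adj x y) {v : V} (h : v ∈ H.verts) :
    ofContractEdge e (toContractEdge e v) = if v = y then x else v := by
  rw [toContractEdge_of_mem e h]
  rfl

theorem toContractEdge_eq (e : H.Adj x y) : toContractEdge e x = toContractEdge e y := by
  rw [toContractEdge_of_mem e e.fst_mem, toContractEdge_of_mem e e.snd_mem]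
  exact Quot.sound ⟨rfl, rfl⟩

theorem toContractEdge_ne (e : H.Adj x y) {u v : V} (huv : s(u, v) ∈ H.edgeSet \ {s(x, y)}) :
    toContractEdge e u ≠ toContractEdge e v := by
  classical
  intro h
  have hadj : H.Adj u v := huv.1
  have hne := huv.2
  rw [Set.mem_singleton_iff] at hne
  have h' := congrArg (ofContractEdge e) h
  rw [ofContractEdge_toContractEdge e hadj.fst_mem,
    ofContractEdge_toContractEdge e hadj.snd_mem] at h'
  have := hadj.ne
  grind

/-- No condition `p ≠ q` is needed: `H` is simple, so the removed edge `xy` is the only one that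
collapses to a loop. -/
theorem contractEdge_adj_iff (e : H.Adj x y)
    {p q : Quot fun a b : H.verts => a = ⟨x, e.fst_mem⟩ ∧ b = ⟨y, e.snd_mem⟩} :
    (H.contractEdge e).Adj p q ↔ ∃ u v, s(u, v) ∈ H.edgeSet \ {s(x, y)} ∧
      toContractEdge e u = p ∧ toContractEdge e v = q := by
  rw [contractEdge, SimpleGraph.contractEdge, map_adj']
  constructor
  · rintro ⟨hne, u, v, huv, rfl, rfl⟩
    refine ⟨u, v, ⟨huv, fun h => ?_⟩, toContractEdge_of_mem e u.2, toContractEdge_of_mem e v.2⟩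
    rw [Set.mem_singleton_iff, Sym2.eq_iff] at h
    rw [← toContractEdge_of_mem e u.2, ← toContractEdge_of_mem e v.2] at hne
    rcases h with ⟨hu, hv⟩ | ⟨hu, hv⟩
    · exact hne (by rw [hu, hv, toContractEdge_eq])
    · exact hne (by rw [hu, hv, toContractEdge_eq])
  · rintro ⟨u, v, huv, rfl, rfl⟩
    have hadj : H.Adj u v := huv.1
    exact ⟨toContractEdge_ne e huv, ⟨u, hadj.fst_mem⟩, ⟨v, hadj.snd_mem⟩, hadj,
      (toContractEdge_of_mem e _).symm, (toContractEdge_of_mem e _).symm⟩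

/-- Membership in either closure is a reachability statement. The projection carries walks that may
use `xy` to the quotient, and the section lifts them back. Edges that become multiple are
identified, so the map need not be injective. -/
theorem isClosureMap_contractMatroid [Finite V] (e : H.Adj x y) :
    Matroid.IsClosureMap (Sym2.map (toContractEdge e)) (H.contractMatroid x y)
      (H.contractEdge e).graphicMatroid where
  image_ground := by
    rw [contractMatroid_ground, graphicMatroid_ground]
    ext b
    induction b with
    | _ p q =>
      rw [mem_edgeSet, contractEdge_adj_iff]
      constructor
      · rintro ⟨a, ha, hab⟩
        induction a with
        | _ u v =>
          rw [Sym2.map_mk, Sym2.eq_iff] at hab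
          rcases hab with ⟨h1, h2⟩ | ⟨h1, h2⟩
          · exact ⟨u, v, ha, h1, h2⟩
          · exact ⟨v, u, (Sym2.eq_swap : s(u, v) = s(v, u)) ▸ ha, h2, h1⟩
      · rintro ⟨u, v, huv, rfl, rfl⟩
        exact ⟨s(u, v), huv, rfl⟩
  mem_closure_iff := by
    classical
    intro X hX a ha
    induction a with
    | _ u v =>
      rw [contractMatroid_ground] at hX ha
      have hadj : H.Adj u v := ha.1
      have hXE : insert s(x, y) X ⊆ G.edgeSet :=
        Set.insert_subset (H.adj_sub e) ((hX.trans Set.sdiff_subset).trans H.edgeSet_subset)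
      have himE : Sym2.map (toContractEdge e) '' X ⊆ (H.contractEdge e).edgeSet := by
        rintro _ ⟨a, ha, rfl⟩
        induction a with
        | _ a b => exact (contractEdge_adj_iff e).2 ⟨a, b, hX ha, rfl, rfl⟩
      rw [closure_contractMatroid, Set.inter_eq_left.2 hX, Set.mem_inter_iff, and_iff_left ha,
        mem_closure_graphicMatroid_iff hXE (H.adj_sub hadj), Sym2.map_mk,
        mem_closure_graphicMatroid_iff himE ((contractEdge_adj_iff e).2 ⟨u, v, ha, rfl, rfl⟩)]
      -- Projecting and lifting moves only `y`, to `x`, and the edge `xy` is available to undo this.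
      have hsec {w : V} (hw : w ∈ H.verts) : (fromEdgeSet (insert s(x, y) X)).Reachable
          (ofContractEdge e (toContractEdge e w)) w := by
        rw [ofContractEdge_toContractEdge e hw]
        split_ifs with h
        · rw [h]
          exact fromEdgeSet_reachable_of_mem (Set.mem_insert _ _)
        · exact Reachable.refl _
      constructor
      · intro h
        refine (hsec hadj.fst_mem).symm.trans (Reachable.trans ?_ (hsec hadj.snd_mem))
        refine h.map_of_forall_adj (ofContractEdge e) fun p q hpq => ?_
        obtain ⟨⟨a, ha, hapq⟩, -⟩ := (fromEdgeSet_adj _).1 hpq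
        induction a with
        | _ a b =>
          have hab : H.Adj a b := (hX ha).1
          have hr : (fromEdgeSet (insert s(x, y) X)).Reachable
              (ofContractEdge e (toContractEdge e a)) (ofContractEdge e (toContractEdge e b)) :=
            ((hsec hab.fst_mem).trans (fromEdgeSet_reachable_of_mem
              (Set.mem_insert_of_mem _ ha))).trans (hsec hab.snd_mem).symm
          rw [Sym2.map_mk, Sym2.eq_iff] at hapq
          rcases hapq with ⟨rfl, rfl⟩ | ⟨rfl, rfl⟩
          · exact hr
          · exact hr.symm
      · intro h
        refine h.map_of_forall_adj (toContractEdge e) fun a b hab => ?_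
        rcases ((fromEdgeSet_adj _).1 hab).1 with h | h
        · rcases Sym2.eq_iff.1 h with ⟨rfl, rfl⟩ | ⟨rfl, rfl⟩
          · rw [toContractEdge_eq]
          · rw [toContractEdge_eq]
        · exact fromEdgeSet_reachable_of_mem ⟨s(a, b), h, rfl⟩

theorem loopless_contractMatroid [Finite V] (e : H.Adj x y) : (H.contractMatroid x y).Loopless := by
  have := Matroid.loopless_contract (isFlat_singleton_graphicMatroid (H.adj_sub e))
  exact (Matroid.restrict_isRestriction _ _ H.sdiff_subset_ground_contract).loopless

theorem klPoly_contractEdge [Finite V] (e : H.Adj x y) :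
    (H.contractEdge e).klPoly = (H.contractMatroid x y).klPoly := by
  have := loopless_contractMatroid e
  exact (isClosureMap_contractMatroid e).klPoly_eq.symm

theorem mem_closure_of_connected_deleteEdges [Finite V] (e : H.Adj x y)
    (hc : (H.deleteEdges {s(x, y)}).Connected) :
    s(x, y) ∈ G.graphicMatroid.closure (H.edgeSet \ {s(x, y)}) := by
  rw [mem_closure_graphicMatroid_iff (Set.sdiff_subset.trans H.edgeSet_subset) (H.adj_sub e)]
  have hr := hc.coe.preconnected ⟨x, e.fst_mem⟩ ⟨y, e.snd_mem⟩
  refine hr.map_of_forall_adj Subtype.val fun a b hab => fromEdgeSet_reachable_of_mem ?_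
  exact hab

end Subgraph

/-! ### Parallel connections -/

namespace IsParallelConnection

variable {G : SimpleGraph V} {H₁ H₂ : G.Subgraph} {x y : V} {e : G.Adj x y}

theorem symm (h : IsParallelConnection H₁ H₂ e) : IsParallelConnection H₂ H₁ e :=
  ⟨sup_comm H₁ H₂ ▸ h.sup_eq, inf_comm H₁ H₂ ▸ h.inf_eq⟩

theorem edgeSet_union (h : IsParallelConnection H₁ H₂ e) :
    H₁.edgeSet ∪ H₂.edgeSet = G.edgeSet := by
  rw [← Subgraph.edgeSet_sup, h.sup_eq, Subgraph.edgeSet_top]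

theorem edgeSet_inter (h : IsParallelConnection H₁ H₂ e) :
    H₁.edgeSet ∩ H₂.edgeSet = {s(x, y)} := by
  rw [← Subgraph.edgeSet_inf, h.inf_eq, edgeSet_subgraphOfAdj]

theorem eq_or_eq_of_mem_verts (h : IsParallelConnection H₁ H₂ e) {v : V} (h₁ : v ∈ H₁.verts)
    (h₂ : v ∈ H₂.verts) : v = x ∨ v = y := by
  have : v ∈ (H₁ ⊓ H₂).verts := ⟨h₁, h₂⟩
  simpa [h.inf_eq] using this

/-- Retract `G` to `H₁` by sending every vertex outside `H₁` to `x`. An edge of `H₂` then has both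
ends in `{x, y}`, and these are joined by the inserted edge, so excursions into `H₂` can be dropped
from a walk. -/
theorem mem_closure_insert_inter [Finite V] (h : IsParallelConnection H₁ H₂ e)
    {X : Set (Sym2 V)} {a : Sym2 V} (ha : a ∈ H₁.edgeSet)
    (hcl : a ∈ G.graphicMatroid.closure (insert s(x, y) X)) :
    a ∈ G.graphicMatroid.closure (insert s(x, y) (X ∩ H₁.edgeSet)) := by
  classical
  induction a with
  | _ u v =>
    have hadj : H₁.Adj u v := ha
    rw [← Matroid.closure_inter_ground, graphicMatroid_ground,
      mem_closure_graphicMatroid_iff Set.inter_subset_right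
      (H₁.adj_sub hadj)] at hcl
    rw [mem_closure_graphicMatroid_iff (Set.insert_subset e
      (Set.inter_subset_right.trans H₁.edgeSet_subset)) (H₁.adj_sub hadj)]
    have hr := hcl.map_of_forall_adj (H := fromEdgeSet (insert s(x, y) (X ∩ H₁.edgeSet)))
      (fun v => if v ∈ H₁.verts then v else x) fun a b hab => ?_
    · simpa [hadj.fst_mem, hadj.snd_mem] using hr
    obtain ⟨⟨hab, habE⟩, -⟩ := (fromEdgeSet_adj _).1 hab
    rw [← h.edgeSet_union] at habE
    rcases habE with habE | habE
    · have hadj : H₁.Adj a b := habE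
      rw [if_pos hadj.fst_mem, if_pos hadj.snd_mem]
      exact fromEdgeSet_reachable_of_mem (hab.imp id fun hab => ⟨hab, habE⟩)
    · have hadj : H₂.Adj a b := habE
      have hx {c : V} (hc : c ∈ H₂.verts) :
          (fromEdgeSet (insert s(x, y) (X ∩ H₁.edgeSet))).Reachable
            (if c ∈ H₁.verts then c else x) x := by
        split_ifs with hc₁
        · rcases h.eq_or_eq_of_mem_verts hc₁ hc with rfl | rfl
          · exact Reachable.refl _
          · exact (fromEdgeSet_reachable_of_mem (Set.mem_insert _ _)).symm
        · exact Reachable.refl _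
      exact (hx hadj.fst_mem).trans (hx hadj.snd_mem).symm

/-- The two sides share only the edge `xy`. Once it is contracted, the edges of one side do not
affect closures on the other. -/
theorem isDirectSum_contract [Finite V] (h : IsParallelConnection H₁ H₂ e) :
    Matroid.IsDirectSum (G.graphicMatroid ／ {s(x, y)}) (H₁.contractMatroid x y)
      (H₂.contractMatroid x y) where
  disjoint := by
    rw [Set.disjoint_left]
    rintro a ⟨ha₁, ha⟩ ⟨ha₂, -⟩
    exact ha (h.edgeSet_inter ▸ ⟨ha₁, ha₂⟩)
  closure_eq X := by
    rw [Subgraph.closure_contractMatroid, Subgraph.closure_contractMatroid,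
      Matroid.contract_closure_eq, Set.union_singleton]
    have key {H H' : G.Subgraph} (h : IsParallelConnection H H' e) {a : Sym2 V}
        (ha : a ∈ H.edgeSet) (hcl : a ∈ G.graphicMatroid.closure (insert s(x, y) X)) :
        a ∈ G.graphicMatroid.closure (insert s(x, y) (X ∩ (H.edgeSet \ {s(x, y)}))) := by
      have := h.mem_closure_insert_inter ha hcl
      rwa [← Set.insert_sdiff_singleton, Set.inter_sdiff_assoc] at this
    ext a
    constructor
    · rintro ⟨hcl, hne⟩
      have haE : a ∈ G.edgeSet := G.graphicMatroid.mem_ground_of_mem_closure hcl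
      rw [← h.edgeSet_union] at haE
      rcases haE with ha | ha
      · exact Or.inl ⟨key h ha hcl, ha, hne⟩
      · exact Or.inr ⟨key h.symm ha hcl, ha, hne⟩
    · rintro (⟨hcl, -, hne⟩ | ⟨hcl, -, hne⟩) <;>
      exact ⟨G.graphicMatroid.closure_subset_closure
        (Set.insert_subset_insert Set.inter_subset_left) hcl, hne⟩

/-- A flat that does not contain the connection edge does not contain all other edges of `H₁`. -/
theorem natRank_contract_pos [Finite V] (h : IsParallelConnection H₁ H₂ e)
    (hc : (H₁.deleteEdges {s(x, y)}).Connected) {F : Set (Sym2 V)}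
    (hF : G.graphicMatroid.IsFlat F) (he : s(x, y) ∉ F)
    [(H₁.contractMatroid x y ／ F).Loopless] : 0 < (H₁.contractMatroid x y ／ F).natRank := by
  rw [Matroid.natRank_eq_natRk_ground]
  -- By looplessness, it suffices that the ground set is nonempty. Otherwise `F` contains all of
  -- `H₁` except `xy`, and a path in that remainder puts `xy` into the closure of `F`.
  refine Matroid.natRk_pos (Matroid.ground_isFlat _) fun hempty => he ?_
  rw [Matroid.contract_ground, Subgraph.contractMatroid_ground, Set.sdiff_eq_empty] at hempty
  rw [← hF.closure]
  exact G.graphicMatroid.closure_subset_closure hempty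
    (Subgraph.mem_closure_of_connected_deleteEdges h.adj_left hc)

end IsParallelConnection

end SimpleGraph

/-! ### The deletion formula for a parallel connection -/

theorem theorem3 {V : Type*} [Finite V] {G : SimpleGraph V} (H₁ H₂ : G.Subgraph) {x y : V}
    (e : G.Adj x y) (h : SimpleGraph.IsParallelConnection H₁ H₂ e)
    (hc₁ : (H₁.deleteEdges {s(x, y)}).Connected)
    (hc₂ : (H₂.deleteEdges {s(x, y)}).Connected) :
    G.klPoly = (G.deleteEdges {s(x, y)}).klPoly -
      X * (H₁.contractEdge h.adj_left).klPoly * (H₂.contractEdge h.adj_right).klPoly := by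
  have hflat := SimpleGraph.isFlat_singleton_graphicMatroid e
  have hloop := Matroid.loopless_contract hflat
  rw [SimpleGraph.Subgraph.klPoly_contractEdge, SimpleGraph.Subgraph.klPoly_contractEdge,
    mul_assoc, ← h.isDirectSum_contract.klPoly_eq, SimpleGraph.klPoly, SimpleGraph.klPoly,
    SimpleGraph.graphicMatroid_deleteEdges]
  refine Matroid.klPoly_eq_deleteElem_sub _ e ?_ hflat fun F hF heF hins => ?_
  -- A path from `x` to `y` in `H₁` avoiding the edge `xy` shows that this edge is not a coloop.
  · rw [Matroid.isColoop_iff_notMem_closure_compl e, not_not]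
    exact Matroid.closure_subset_closure _ (Set.sdiff_subset_sdiff_left H₁.edgeSet_subset)
      (SimpleGraph.Subgraph.mem_closure_of_connected_deleteEdges h.adj_left hc₁)
  · have hsum := h.isDirectSum_contract.contract F
    rw [Matroid.contract_contract, Set.singleton_union] at hsum
    have hl := Matroid.loopless_contract hins
    have hl₁ := hsum.loopless_left
    have hl₂ := hsum.symm.loopless_left
    -- Each factor satisfies `2 * deg + 1 ≤ rank`, so the product satisfies `2 * deg + 2 ≤ rank`,
    -- the extra unit that is required.
    have hd₁ := Matroid.isKLFamily_klPoly.degree_lt _ hl₁ (h.natRank_contract_pos hc₁ hF heF)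
    have hd₂ := Matroid.isKLFamily_klPoly.degree_lt _ hl₂ (h.symm.natRank_contract_pos hc₂ hF heF)
    rw [hsum.klPoly_eq, hsum.natRank_eq]
    have := natDegree_mul_le (p := (H₁.contractMatroid x y ／ F).klPoly)
      (q := (H₂.contractMatroid x y ／ F).klPoly)
    omega
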